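/- Let $k$ be a field, let $a<b$ be coprime positive integers, let $r\ge 0$, and put $m_i=a^{r+1-i}b^{i-1}$ for $1\le i\le r+1$, so that $m_1=a^r$, $m_2=a^{r-1}b$, ..., $m_{r+1}=b^r$. Let $S$ be the numerical semigroup generated by $m_1,\dots,m_{r+1}$ (if $a\ge 2$, these are its minimal generators), and let $k[S]=k[t^{m_1},\dots,t^{m_{r+1}}]\subseteq k[t]$ be its semigroup ring. Let $\mathfrak p$ be the kernel of the $k$-algebra homomorphism $\eta:k[z_1,\dots,z_{r+1}]\to k[S]$, $z_i\mapsto t^{m_i}$. Let $\overline{\mathfrak p}\subseteq k[z_0,\dots,z_{r+1}]$ be the homogenization of $\mathfrak p$ with respect to $z_0$, that is, the ideal generated by the homogenizations of all elements of $\mathfrak p$, and let $\overline{k[S]}=k[z_0,\dots,z_{r+1}]/\overline{\mathfrak p}$ be the homogeneous coordinate ring of the projective closure of the affine monomial curve defined by $\mathfrak p$. Then: 1. $\eta$ is surjective, and $k[S]\cong k[z_1,\dots,z_{r+1}]/\mathfrak p$ is a complete intersection: the minimal number of generators of $\mathfrak p$ equals the height of $\mathfrak p$. 2. $\overline{\mathfrak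 p}$ is the kernel of the $k$-algebra homomorphism $\eta^h:k[z_0,\dots,z_{r+1}]\to k[u,v]$ with $z_0\mapsto v^{m_{r+1}}$ and $z_i\mapsto u^{m_i}v^{m_{r+1}-m_i}$ for $1\le i\le r+1$, and $\overline{k[S]}$ is a complete intersection: the minimal number of generators of $\overline{\mathfrak p}$ equals the height of $\overline{\mathfrak p}$. 3. $\overline{k[S]}$ is Cohen--Macaulay (it is Noetherian, and at every prime ideal the depth of the local ring equals its Krull dimension) and Gorenstein (it is Noetherian, and at every prime ideal the local ring has finite injective dimension as a module over itself). -/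

import Mathlib

universe u v

noncomputable section

/-! ### Complete intersections, Cohen-Macaulay rings, Gorenstein rings -/

/-- A presentation `φ : k[x₁, …, xₙ] → R` of a `k`-algebra `R` exhibits `R` as a complete
intersection if it is surjective and the minimal number of generators of its kernel (the defining
ideal) equals the height of the kernel. -/
structure IsCompleteIntersectionVia {k : Type u} [Field k] {n : ℕ} {R : Type v} [CommRing R]
    [Algebra k R] (φ : MvPolynomial (Fin n) k →ₐ[k] R) : Prop where
  surjective : Function.Surjective φ
  spanFinrank_eq_height :
    ((RingHom.ker φ).spanFinrank : ℕ∞) = (RingHom.ker φ).height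

/-- The depth of a local ring: the supremum of the lengths of the regular sequences contained in
the maximal ideal. -/
def localRingDepth (R : Type u) [CommRing R] [IsLocalRing R] : ℕ∞ :=
  ⨆ rs : {rs : List R // (∀ x ∈ rs, x ∈ IsLocalRing.maximalIdeal R) ∧
    RingTheory.Sequence.IsRegular R rs}, (rs.1.length : ℕ∞)

/-- A ring is Cohen-Macaulay if it is Noetherian and, at every prime, the depth of the local ring
equals its Krull dimension. -/
structure IsCohenMacaulayRing (R : Type u) [CommRing R] : Prop where
  isNoetherianRing : IsNoetherianRing R
  depth_eq_dim (p : Ideal R) [p.IsPrime] :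
    ((localRingDepth (Localization.AtPrime p) : ℕ∞) : WithBot ℕ∞) =
      ringKrullDim (Localization.AtPrime p)

/-- A ring is Gorenstein if it is Noetherian and, at every prime, the local ring has finite
injective dimension as a module over itself. -/
structure IsGorensteinRing (R : Type u) [CommRing R] : Prop where
  isNoetherianRing : IsNoetherianRing R
  finite_injectiveDimension (p : Ideal R) [p.IsPrime] :
    ∃ d : ℕ, CategoryTheory.HasInjectiveDimensionLE
      (ModuleCat.of (Localization.AtPrime p) (Localization.AtPrime p)) d

/-! ### Homogenization -/

/-- The homogenization `f^h = z₀ ^ (deg f) * f(z₁ / z₀, …, zₙ / z₀)` of a polynomial in `n`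
variables; the new variable has index `0`, and the old variable `i` becomes `i.succ`. -/
def homogenizePoly {k : Type u} [Field k] {n : ℕ} (f : MvPolynomial (Fin n) k) :
    MvPolynomial (Fin (n + 1)) k :=
  ∑ d ∈ f.support, MvPolynomial.monomial (Finsupp.cons (f.totalDegree - d.degree) d) (f.coeff d)

/-- The homogenization of an ideal: the ideal generated by the homogenizations of all of its
elements. For the ideal of an affine variety this is the ideal of the projective closure. -/
def homogenizeIdeal {k : Type u} [Field k] {n : ℕ} (I : Ideal (MvPolynomial (Fin n) k)) :
    Ideal (MvPolynomial (Fin (n + 1)) k) :=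
  Ideal.span (homogenizePoly '' (I : Set (MvPolynomial (Fin n) k)))

/-! ### The numerical semigroup generated by a geometric sequence -/

/-- The generators `a ^ r, a ^ (r - 1) * b, …, a * b ^ (r - 1), b ^ r`, indexed from `0`. -/
def geomGen (a b r : ℕ) (i : Fin (r + 1)) : ℕ := a ^ (r - (i : ℕ)) * b ^ (i : ℕ)

/-- The semigroup ring `k[S] = k[t ^ m : m a generator of S] ⊆ k[t]`. -/
def geomRing (k : Type u) [Field k] (a b r : ℕ) : Subalgebra k (Polynomial k) :=
  Algebra.adjoin k (Set.range fun i : Fin (r + 1) => (Polynomial.X : Polynomial k) ^ geomGen a b r i)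

/-- The presentation `η : k[z₁, …, z_{r+1}] → k[S]`, sending each variable to the power of `t`
given by the corresponding generator of `S`. -/
def geomParam (k : Type u) [Field k] (a b r : ℕ) :
    MvPolynomial (Fin (r + 1)) k →ₐ[k] geomRing k a b r :=
  MvPolynomial.aeval fun i =>
    ⟨Polynomial.X ^ geomGen a b r i, Algebra.subset_adjoin ⟨i, rfl⟩⟩

/-- The defining ideal of the affine monomial curve. -/
def geomIdeal (k : Type u) [Field k] (a b r : ℕ) : Ideal (MvPolynomial (Fin (r + 1)) k) :=
  RingHom.ker (geomParam k a b r)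

/-- The defining ideal of the projective closure of the affine monomial curve. -/
def geomProjIdeal (k : Type u) [Field k] (a b r : ℕ) : Ideal (MvPolynomial (Fin (r + 2)) k) :=
  homogenizeIdeal (geomIdeal k a b r)

/-- The homogeneous coordinate ring of the projective closure. -/
abbrev GeomProjRing (k : Type u) [Field k] (a b r : ℕ) : Type u :=
  MvPolynomial (Fin (r + 2)) k ⧸ geomProjIdeal k a b r

/-- The map `η^h : k[z₀, …, z_{r+1}] → k[u, v]` with `z₀ ↦ v ^ M` and `zᵢ ↦ u ^ mᵢ * v ^ (M - mᵢ)`,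
where `M = b ^ r` is the largest generator; `u` and `v` are the variables `0` and `1`. -/
def geomProjParam (k : Type u) [Field k] (a b r : ℕ) :
    MvPolynomial (Fin (r + 2)) k →ₐ[k] MvPolynomial (Fin 2) k :=
  MvPolynomial.aeval <| Fin.cons (MvPolynomial.X 1 ^ b ^ r) fun i : Fin (r + 1) =>
    MvPolynomial.X 0 ^ geomGen a b r i * MvPolynomial.X 1 ^ (b ^ r - geomGen a b r i)

end

/-!
The generators of the semigroup satisfy `b * m_i = a * m_{i+1}`, so the ideal of the affine curve
contains the `r` binomials `f_i = z_i ^ b - z_{i+1} ^ a`, and the ideal of its projective closure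
contains their homogenizations `F_i = z_i ^ b - z_0 ^ (b - a) * z_{i+1} ^ a`. Everything rests on
two facts about these.

*They generate.* Modulo the `F_i`, every monomial reduces to one in which `z_1, …, z_r` have
exponents less than `b` (`exists_reduced`). All `m_i` but the first are divisible by `b` and the
first is prime to `b`, so such a reduced monomial is determined by its image in `k[u, v]`
(`eq_of_geomExp_eq`). Hence the kernel of `geomProjParam` is generated by the `F_i`
(`ker_geomProjParam`). It contains the homogenization of every element of the affine ideal, and so
equals the homogenized ideal (`geomProjIdeal_eq_ker`); dehomogenizing gives the generators of the
affine ideal (`geomIdeal_eq_span`).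

*The height is `r`.* By Krull's height theorem the heights are at most `r`. Multiplying the images of
the first `c` of the variables `z_1, …, z_r` by new independent variables, for `c = r, …, 0`, gives
a chain of prime kernels; the `F_i`, respectively `f_i`, show that it is strictly ascending
(`le_height_ker_of_triangular`).

The reduced monomials also show that the homogeneous coordinate ring `A` is a free module of finite
rank over `B = k[z_0, z_{r+1}]`, with basis the monomials in `z_1, …, z_r` with exponents less than
`b`. Taking the coefficient of the monomial with all exponents equal to `b - 1` is a `B`-linear form
`l` with respect to which the complementary monomials form the dual basis
(`socleFormQuotient_boxClass_mul`).

*Cohen-Macaulay.* `B` is a factorial domain of dimension two. For a prime `p` of `A`, the contraction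
of `p` to `B` has at least the height of `p`, so it contains a regular sequence of that length, which
stays regular on the flat `B`-algebra `A` and on its localizations
(`IsCohenMacaulayRing.of_finite_flat`).

*Gorenstein.* The form `l` identifies `A` with `Hom_B(A, B)`. The functor `Hom_B(A, ·)` is exact and
preserves injectives, so it does not raise injective dimensions, and every `B`-module has injective
dimension at most two (`ModuleCat.hasInjectiveDimensionLE_mvPolynomial`). Injective dimension does
not grow under localization of Noetherian rings.
-/

/-! ### Injective dimension under coinduction and over polynomial rings -/

namespace ModuleCat

open CategoryTheory

section Coextension

variable {R S : Type u} [CommRing R] [CommRing S] (f : R →+* S)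

instance : (coextendScalars.{u, u, u} f).PreservesInjectiveObjects :=
  Functor.preservesInjectiveObjects_of_adjunction_of_preservesMonomorphisms
    (restrictCoextendScalarsAdj.{u, u, u} f)

/-- Coinduction along `f : R → S` is the functor `Hom_R(S, ·)`, so it is exact when `S` is projective
over `R`. -/
lemma coextendScalars_map_shortExact
    [Module.Projective R ((restrictScalars.{u} f).obj (ModuleCat.of S S))]
    {T : ShortComplex (ModuleCat.{u} R)} (hT : T.ShortExact) :
    (T.map (coextendScalars.{u, u, u} f)).ShortExact := by
  have hex : Function.Exact T.f T.g :=
    (ShortComplex.ShortExact.moduleCat_exact_iff_function_exact _).mp hT.1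
  have hinj : Function.Injective T.f := (mono_iff_injective _).mp hT.mono_f
  have hsurj : Function.Surjective T.g := (epi_iff_surjective _).mp hT.epi_g
  refine shortComplex_shortExact _ ?_ ?_ ?_
  · intro g
    constructor
    · intro hg
      have hg' : ∀ s : (restrictScalars.{u} f).obj (ModuleCat.of S S),
          ∃ x, T.f x = CoextendScalars.equiv f T.X₂ g s := fun s =>
        (hex _).1 (LinearMap.congr_fun
          (congrArg (CoextendScalars.equiv f T.X₃) hg : _) s)
      choose h hh using hg'
      refine ⟨(CoextendScalars.equiv f T.X₁).symm
        { toFun := h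
          map_add' := fun x y => hinj ?_
          map_smul' := fun r x => hinj ?_ }, ?_⟩
      · rw [hh, map_add, map_add, hh, hh]
      · rw [hh, map_smul, RingHom.id_apply, map_smul, hh]
      · exact CoextendScalars.ext (LinearMap.ext fun s => hh s)
    · rintro ⟨g, rfl⟩
      exact CoextendScalars.ext (LinearMap.ext fun s => (hex _).2 ⟨_, rfl⟩)
  · intro g g' h
    exact CoextendScalars.ext (LinearMap.ext fun s => hinj
      (LinearMap.congr_fun (congrArg (CoextendScalars.equiv f T.X₂) h : _) s))
  · intro g
    obtain ⟨h, hh⟩ := Module.projective_lifting_property T.g.hom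
      (CoextendScalars.equiv f T.X₃ g) hsurj
    exact ⟨(CoextendScalars.equiv f T.X₂).symm h, CoextendScalars.ext hh⟩

/-- Coinduction along `f : R → S`, with `S` projective over `R`, is exact and preserves injectives,
hence does not raise injective dimensions. -/
lemma coextendScalars_hasInjectiveDimensionLE
    [Module.Projective R ((restrictScalars.{u} f).obj (ModuleCat.of S S))]
    (n : ℕ) (N : ModuleCat.{u} R) [HasInjectiveDimensionLE N n] :
    HasInjectiveDimensionLE ((coextendScalars.{u, u, u} f).obj N) n := by
  induction n generalizing N with
  | zero =>
    have h : HasInjectiveDimensionLE N 0 := ‹_›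
    simp only [HasInjectiveDimensionLE, zero_add, ← injective_iff_hasInjectiveDimensionLT_one]
      at h ⊢
    exact (coextendScalars.{u, u, u} f).injective_obj N
  | succ n ih =>
    obtain ⟨⟨I, hI, i, hi⟩⟩ := EnoughInjectives.presentation N
    let T := ShortComplex.mk i (Limits.cokernel.π i) (Limits.cokernel.condition i)
    have hT : T.ShortExact := { exact := ShortComplex.exact_cokernel i }
    have := (hT.hasInjectiveDimensionLT_X₃_iff n ‹_›).mpr ‹_›
    have hI' : Injective (T.map (coextendScalars.{u, u, u} f)).X₂ :=
      (coextendScalars.{u, u, u} f).injective_obj I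
    exact ((coextendScalars_map_shortExact f hT).hasInjectiveDimensionLT_X₃_iff n hI').mp
      (ih T.X₃)

end Coextension

open Polynomial in
/-- The injective dimension of a module over `R[X]` exceeds that over `R` by at most one. A module
`M` over `R[X]` embeds by `m ↦ (p ↦ p • m)` into the coinduced module `Hom_R(R[X], M)`, and the image
is the kernel of the surjective endomorphism `g ↦ (p ↦ X • g p - g (X * p))`. -/
lemma hasInjectiveDimensionLE_polynomial {R : Type u} [CommRing R] (n : ℕ)
    (M : ModuleCat.{u} R[X])
    [HasInjectiveDimensionLE ((restrictScalars.{u} (C : R →+* R[X])).obj M) n] :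
    HasInjectiveDimensionLE M (n + 1) := by
  let N := (restrictScalars.{u} (C : R →+* R[X])).obj M
  let P := (restrictScalars.{u} (C : R →+* R[X])).obj (ModuleCat.of R[X] R[X])
  let H := (coextendScalars.{u, u, u} (C : R →+* R[X])).obj N
  -- `P` is `R[X]` with the scalar action through `C`; `e` is the identity map.
  let e : R[X] ≃ₗ[R] P :=
    { AddEquiv.refl R[X] with map_smul' := fun r p => Polynomial.smul_eq_C_mul r }
  let bas : Module.Basis ℕ R P := (Polynomial.basisMonomials R).map e
  have hbas (n : ℕ) : bas n = e (X ^ n) := by simp [bas, ← Polynomial.monomial_one_right_eq_X_pow]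
  have hproj : Module.Projective R P := Module.Projective.of_basis bas
  have hH := coextendScalars_hasInjectiveDimensionLE (C : R →+* R[X]) n N
  let ι : M →ₗ[R[X]] H := RestrictionCoextensionAdj.app' C M
  let mulX : N →ₗ[R] N :=
    { toFun := fun m => (X • (m : M) : M)
      map_add' := fun x y => smul_add (X : R[X]) (x : M) (y : M)
      map_smul' := fun r m => smul_comm (X : R[X]) (C r) (m : M) }
  let shift : P →ₗ[R] P :=
    { toFun := fun p => e (X * e.symm p)
      map_add' := fun x y => by simp [mul_add]
      map_smul' := fun r m => by simp }
  let evL (g : H) : P →ₗ[R] N := CoextendScalars.equiv C N g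
  let ev (g : H) (p : R[X]) : M := evL g (e p)
  let δ : H →ₗ[R[X]] H :=
    { toFun := fun g => (CoextendScalars.equiv C N).symm (mulX ∘ₗ evL g - evL g ∘ₗ shift)
      map_add' := fun g h => CoextendScalars.ext (LinearMap.ext fun p => by
        simp [evL]; abel)
      map_smul' := fun q g => CoextendScalars.ext (LinearMap.ext fun p => by
        change (X : R[X]) • ev g (e.symm p * q) - ev g (X * e.symm p * q) =
          (X : R[X]) • ev g (e.symm p * q) - ev g (X * (e.symm p * q))
        rw [mul_assoc]) }
  have δ_apply (g : H) (p : R[X]) :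
      ev (δ g) p = (X : R[X]) • ev g p - ev g (X * p) := rfl
  have ι_apply (m : M) (p : R[X]) : ev (ι m) p = p • m := rfl
  have ev_ext (g h : H) (hgh : ∀ n, ev g (X ^ n) = ev h (X ^ n)) : g = h :=
    (CoextendScalars.equiv C N).injective (bas.ext fun n => by rw [hbas]; exact hgh n)
  have hinj : Function.Injective ι := fun m m' h => by
    have h1 := ι_apply m 1
    rw [h, ι_apply, one_smul, one_smul] at h1
    exact h1.symm
  have hex : Function.Exact ι δ := by
    intro g
    constructor
    · intro hg
      have hg' (p : R[X]) : ev g (X * p) = (X : R[X]) • ev g p := by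
        have := δ_apply g p
        rw [hg] at this
        exact (sub_eq_zero.1 this.symm).symm
      refine ⟨ev g 1, ev_ext _ _ fun n => ?_⟩
      rw [ι_apply]
      induction n with
      | zero => simp
      | succ n ih => rw [pow_succ', hg', mul_smul, ih]
    · rintro ⟨m, rfl⟩
      refine ev_ext _ _ fun p => ?_
      rw [δ_apply, ι_apply, ι_apply, mul_smul, sub_self]
      rfl
  have hsurj : Function.Surjective δ := by
    intro h
    -- A preimage `g` of `h` is determined by `g 1 = 0` and the recursion
    -- `g (X ^ (i + 1)) = X • g (X ^ i) - h (X ^ i)`.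
    let s : ℕ → M := fun n => Nat.rec (0 : M)
      (fun i t => (X : R[X]) • t - ev h (X ^ i)) n
    let g : H := (CoextendScalars.equiv C N).symm (bas.constr ℕ s)
    have hs (n : ℕ) : ev g (X ^ n) = s n := by
      have := bas.constr_basis ℕ (M' := N) s n
      rwa [hbas] at this
    refine ⟨g, ev_ext _ _ fun n => ?_⟩
    rw [δ_apply, ← pow_succ', hs, hs]
    exact sub_sub_cancel _ _
  have hT : (ShortComplex.mk (ofHom ι) (ofHom δ)
      (hom_ext (LinearMap.ext hex.apply_apply_eq_zero))).ShortExact :=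
    shortComplex_shortExact _ hex hinj hsurj
  exact hT.hasInjectiveDimensionLT_X₁ (n + 1) hH
    (hasInjectiveDimensionLT_of_ge _ (n + 1) _ (by simp))

attribute [local instance] RingHomInvPair.of_ringEquiv in
/-- Every module over a polynomial ring in `n` variables over a field has injective dimension
at most `n`. -/
lemma hasInjectiveDimensionLE_mvPolynomial {k : Type u} [Field k] (n : ℕ)
    (M : ModuleCat.{u} (MvPolynomial (Fin n) k)) : HasInjectiveDimensionLE M n := by
  induction n with
  | zero =>
    let e := MvPolynomial.isEmptyRingEquiv k (Fin 0)
    have : IsSemisimpleRing (MvPolynomial (Fin 0) k) := e.symm.isSemisimpleRing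
    have := Module.injective_of_isSemisimpleRing (MvPolynomial (Fin 0) k) M
    have : Injective M := Module.injective_object_of_injective_module _ M
    exact injective_iff_hasInjectiveDimensionLT_one.1 this
  | succ n ih =>
    let e := (MvPolynomial.finSuccEquiv k n).toRingEquiv
    let M' := (restrictScalars.{u} (RingHomClass.toRingHom e.symm)).obj M
    have := ih ((restrictScalars.{u} Polynomial.C).obj M')
    have := hasInjectiveDimensionLE_polynomial n M'
    let l : M' ≃ₛₗ[RingHomClass.toRingHom e.symm] M :=
      { AddEquiv.refl M with map_smul' := fun _ _ => rfl }
    exact (hasInjectiveDimensionLE_iff_of_semiLinearEquiv.{u, u} e.symm l _).1 this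

end ModuleCat

/-! ### Frobenius forms and the Gorenstein property -/

section Frobenius

open CategoryTheory

variable {R S : Type u} [CommRing R] [CommRing S] [Algebra R S] {ι : Type*} [Fintype ι]
  [DecidableEq ι] {x y : ι → S} {l : S →ₗ[R] R}

lemma linearIndependent_of_dual (hdual : ∀ i j, l (x i * y j) = if i = j then 1 else 0) :
    LinearIndependent R x := by
  rw [Fintype.linearIndependent_iff]
  intro g hg i
  have := congrArg (fun s => l (s * y i)) hg
  simpa [Finset.sum_mul, hdual] using this

/-- If `S` is spanned over `R` by a family `x` having a dual family `y` with respect to the bilinear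
form `(s, t) ↦ l (s * t)`, then `s ↦ l (s * ·)` identifies `S` with `Hom_R(S, R)`. -/
lemma bijective_mul_of_dual (hspan : Submodule.span R (Set.range x) = ⊤)
    (hdual : ∀ i j, l (x i * y j) = if i = j then 1 else 0) :
    Function.Bijective fun s : S => l ∘ₗ LinearMap.mulLeft R s := by
  constructor
  · intro s t hst
    have key (s : S) : ∀ c : ι → R, ∑ i, c i • x i = s → ∀ i, l (s * y i) = c i := by
      rintro c rfl i
      simp [Finset.sum_mul, hdual]
    obtain ⟨c, hc⟩ := (Submodule.mem_span_range_iff_exists_fun R).1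
      (hspan ▸ Submodule.mem_top : s ∈ Submodule.span R (Set.range x))
    obtain ⟨d, hd⟩ := (Submodule.mem_span_range_iff_exists_fun R).1
      (hspan ▸ Submodule.mem_top : t ∈ Submodule.span R (Set.range x))
    have hcd : c = d := funext fun i => by
      rw [← key s c hc i, ← key t d hd i]
      exact LinearMap.congr_fun hst (y i)
    rw [← hc, ← hd, hcd]
  · intro φ
    refine ⟨∑ i, φ (x i) • y i, LinearMap.ext_on_range hspan fun j => ?_⟩
    simp [Finset.sum_mul, mul_comm (y _) (x j), hdual]

/-- In the presence of dual families, `S` is as an `S`-module coinduced from the `R`-module `R`, so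
its injective dimension is at most that of `R`. -/
lemma hasInjectiveDimensionLE_of_dual (hspan : Submodule.span R (Set.range x) = ⊤)
    (hdual : ∀ i j, l (x i * y j) = if i = j then 1 else 0) (n : ℕ)
    [HasInjectiveDimensionLE (ModuleCat.of R R) n] :
    HasInjectiveDimensionLE (ModuleCat.of S S) n := by
  let f := algebraMap R S
  let P := (ModuleCat.restrictScalars.{u} f).obj (ModuleCat.of S S)
  let e : S ≃ₗ[R] P := { AddEquiv.refl S with map_smul' := fun r s => Algebra.smul_def r s }
  have hP : Module.Projective R P := Module.Projective.of_basis
    ((Module.Basis.mk (linearIndependent_of_dual hdual) hspan.ge).map e)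
  have := ModuleCat.coextendScalars_hasInjectiveDimensionLE f n (ModuleCat.of R R)
  let φ : S →ₗ[S] (ModuleCat.coextendScalars.{u, u, u} f).obj (ModuleCat.of R R) :=
    { toFun := fun s => (ModuleCat.CoextendScalars.equiv f (ModuleCat.of R R)).symm
        ((l ∘ₗ LinearMap.mulLeft R s) ∘ₗ e.symm.toLinearMap)
      map_add' := fun s t => ModuleCat.CoextendScalars.ext (LinearMap.ext fun p =>
        (congrArg l (add_mul s t (e.symm p))).trans (map_add l _ _))
      map_smul' := fun s t => ModuleCat.CoextendScalars.ext (LinearMap.ext fun p => by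
        change l (s * t * e.symm p) = l (t * (e.symm p * s))
        congr 1; ring) }
  have hφ : Function.Bijective φ :=
    (e.congrLeft R R).bijective.comp (bijective_mul_of_dual hspan hdual)
  exact hasInjectiveDimensionLT_of_iso (LinearEquiv.ofBijective φ hφ).symm.toModuleIso _

end Frobenius

open CategoryTheory in
/-- Over a Noetherian ring, localization preserves finite injective dimension. -/
lemma IsGorensteinRing.of_hasInjectiveDimensionLE {R : Type u} [CommRing R] [IsNoetherianRing R]
    (n : ℕ) [HasInjectiveDimensionLE (ModuleCat.of R R) n] : IsGorensteinRing R where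
  isNoetherianRing := ‹_›
  finite_injectiveDimension p hp := ⟨n, by
    have := ModuleCat.localizedModule_hasInjectiveDimensionLE n p.primeCompl (ModuleCat.of R R)
    have : IsLocalizedModule p.primeCompl
        ((ModuleCat.of R R).localizedModuleMkLinearMap p.primeCompl) :=
      ModuleCat.localizedModule_isLocalizedModule (ModuleCat.of R R) p.primeCompl
    let e : (ModuleCat.of R R).localizedModule p.primeCompl ≃ₗ[Localization.AtPrime p]
        Localization.AtPrime p := LinearEquiv.extendScalarsOfIsLocalization p.primeCompl
        (Localization.AtPrime p) (IsLocalizedModule.linearEquiv p.primeCompl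
        ((ModuleCat.of R R).localizedModuleMkLinearMap p.primeCompl)
        (Algebra.linearMap R (Localization.AtPrime p)))
    exact hasInjectiveDimensionLT_of_iso e.toModuleIso _⟩

/-! ### Regular sequences and the Cohen-Macaulay property -/

section Depth

open RingTheory.Sequence

lemma localRingDepth_le_ringKrullDim (R : Type u) [CommRing R] [IsLocalRing R]
    [IsNoetherianRing R] : ((localRingDepth R : ℕ∞) : WithBot ℕ∞) ≤ ringKrullDim R := by
  obtain ⟨d, hd⟩ : ∃ d : ℕ∞, ringKrullDim R = d :=
    (WithBot.ne_bot_iff_exists.1 ringKrullDim_ne_bot).imp fun _ h => h.symm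
  rw [hd, WithBot.coe_le_coe]
  refine iSup_le fun ⟨rs, hrs, hreg⟩ => ?_
  have h := ringKrullDim_add_length_eq_ringKrullDim_of_isRegular rs hreg
  have : Nontrivial (R ⧸ Ideal.ofList rs) := Ideal.Quotient.nontrivial_iff.2 fun htop =>
    hreg.2 (by simp [htop])
  have h0 : (0 : WithBot ℕ∞) ≤ ringKrullDim (R ⧸ Ideal.ofList rs) :=
    ringKrullDim_nonneg_of_nontrivial
  rw [← WithBot.coe_le_coe, ← hd, ← h]
  simpa using add_le_add_left h0 (rs.length : WithBot ℕ∞)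

/-- In a Noetherian factorial domain, a nonzero prime contains a prime element `g`, and a prime
of height at least two contains an element outside `(g)`. -/
lemma exists_isWeaklyRegular_of_height_le_two {R : Type u} [CommRing R] [IsDomain R]
    [UniqueFactorizationMonoid R] [IsNoetherianRing R] (p : Ideal R) [p.IsPrime] {n : ℕ}
    (hn : n ≤ 2) (hp : n ≤ p.height) :
    ∃ rs : List R, rs.length = n ∧ (∀ x ∈ rs, x ∈ p) ∧ IsWeaklyRegular R rs := by
  obtain rfl | hn0 := Nat.eq_zero_or_pos n
  · exact ⟨[], by simp⟩
  have hbot : p ≠ ⊥ := by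
    rintro rfl
    have : (1 : ℕ∞) ≤ 0 := by
      rw [← Ideal.height_bot (R := R)]; exact le_trans (by exact_mod_cast hn0) hp
    simp at this
  obtain ⟨g, hgp, hg⟩ := Ideal.IsPrime.exists_mem_prime_of_ne_bot ‹p.IsPrime› hbot
  have hreg : IsSMulRegular R g := IsSMulRegular.of_ne_zero hg.ne_zero
  obtain rfl | rfl : n = 1 ∨ n = 2 := by omega
  · exact ⟨[g], rfl, by simpa using hgp, by simpa [isWeaklyRegular_cons_iff] using hreg⟩
  obtain ⟨h, hhp, hhg⟩ : ∃ h ∈ p, h ∉ Ideal.span {g} := by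
    by_contra! hcon
    have := (Ideal.height_mono hcon).trans (Ideal.height_span_singleton_le_one hg.not_isUnit)
    have := hp.trans this
    exact absurd this (by decide)
  refine ⟨[g, h], rfl, by simp [hgp, hhp], ?_⟩
  rw [isWeaklyRegular_cons_iff, isWeaklyRegular_cons_iff]
  refine ⟨hreg, ?_, by simp⟩
  rw [isSMulRegular_quotient_iff_mem_of_smul_mem]
  intro x hx
  simp only [← Submodule.ideal_span_singleton_smul, smul_eq_mul, Ideal.mul_top] at hx ⊢
  have : (Ideal.span {g}).IsPrime := (Ideal.span_singleton_prime hg.ne_zero).2 hg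
  exact (this.mem_or_mem hx).resolve_left hhg

/-- Heights do not drop under contraction along an integral extension, so the regular sequences
needed in `S` can be chosen in `R`; flatness of `S` over `R` keeps them regular. -/
lemma IsCohenMacaulayRing.of_finite_flat {R S : Type u} [CommRing R] [CommRing S] [Algebra R S]
    [IsDomain R] [UniqueFactorizationMonoid R] [IsNoetherianRing R] [Module.Finite R S]
    [Module.Flat R S] (hR : ringKrullDim R ≤ 2) : IsCohenMacaulayRing S where
  isNoetherianRing := IsNoetherianRing.of_finite R S
  depth_eq_dim p hp := by
    have : IsNoetherianRing S := IsNoetherianRing.of_finite R S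
    refine le_antisymm (localRingDepth_le_ringKrullDim _) ?_
    rw [IsLocalization.AtPrime.ringKrullDim_eq_height p, WithBot.coe_le_coe]
    have h1 : p.height ≤ (p.under R).height := by
      rw [PrimeSpectrum.height_eq_orderHeight ⟨p, hp⟩,
        PrimeSpectrum.height_eq_orderHeight ⟨p.under R, inferInstance⟩]
      exact Order.height_le_height_apply_of_strictMono
        (PrimeSpectrum.comap (algebraMap R S)) (fun _ _ h => Ideal.IsIntegral.comap_lt_comap h)
        ⟨p, hp⟩
    have h2 : (p.under R).height ≤ 2 := by
      have := (Ideal.height_le_ringKrullDim_of_isPrime (I := p.under R)).trans hR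
      exact WithBot.coe_le_coe.1 this
    obtain ⟨n, hn⟩ := ENat.ne_top_iff_exists.1 (h1.trans h2 |>.trans_lt (by decide)).ne
    rw [← hn] at h1 ⊢
    obtain ⟨rs, hlen, hmem, hreg⟩ := exists_isWeaklyRegular_of_height_le_two (p.under R)
      (by exact_mod_cast h1.trans h2) h1
    have hS := IsWeaklyRegular.of_flat (S := S) hreg
    have hloc := hS.isRegular_of_isLocalization_of_mem (Localization.AtPrime p) p (by
      simpa using hmem)
    rw [← hlen]
    refine le_iSup_of_le ⟨_, ?_, hloc⟩ (by simp)
    intro y hy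
    obtain ⟨z, hz, rfl⟩ := List.mem_map.1 hy
    obtain ⟨x, hx, rfl⟩ := List.mem_map.1 hz
    exact (IsLocalization.AtPrime.to_map_mem_maximal_iff _ p _).2 (hmem x hx)

end Depth

/-! ### The height of the kernel of a homomorphism from a polynomial ring -/

section HeightOfKernel

open MvPolynomial

variable {k σ D : Type*} [Field k] [CommRing D] [Algebra k D]

/-- The algebra homomorphism that multiplies the value `φ (X i)` by a new variable `X i` whenever
`ρ i < c`. The kernels shrink as `c` grows, from the kernel of `φ` at `c = 0`. -/
noncomputable def twistAlgHom (φ : MvPolynomial σ k →ₐ[k] D) (ρ : σ → ℕ) (c : ℕ) :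
    MvPolynomial σ k →ₐ[k] MvPolynomial σ D :=
  aeval fun i => C (φ (X i)) * if ρ i < c then X i else 1

lemma twistAlgHom_X (φ : MvPolynomial σ k →ₐ[k] D) (ρ : σ → ℕ) (c : ℕ) (i : σ) :
    twistAlgHom φ ρ c (X i) = C (φ (X i)) * if ρ i < c then X i else 1 := by
  simp [twistAlgHom]

lemma twistAlgHom_eq_C (φ : MvPolynomial σ k →ₐ[k] D) (ρ : σ → ℕ) (c : ℕ) {g : MvPolynomial σ k}
    (hg : g ∈ Algebra.adjoin k (X '' {i | c ≤ ρ i})) : twistAlgHom φ ρ c g = C (φ g) := by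
  have h : Set.EqOn (twistAlgHom φ ρ c)
      (((Algebra.ofId D (MvPolynomial σ D)).restrictScalars k).comp φ) (X '' {i | c ≤ ρ i}) := by
    rintro _ ⟨i, hi, rfl⟩
    simp [twistAlgHom_X, not_lt.2 (show c ≤ ρ i from hi), Algebra.ofId_apply,
      MvPolynomial.algebraMap_eq]
  exact AlgHom.eqOn_adjoin_iff.2 h hg

lemma ker_twistAlgHom_zero (φ : MvPolynomial σ k →ₐ[k] D) (ρ : σ → ℕ) :
    RingHom.ker (twistAlgHom φ ρ 0) = RingHom.ker φ := by
  ext g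
  have : g ∈ Algebra.adjoin k (X '' {i | 0 ≤ ρ i}) := by simp [adjoin_range_X]
  simp [RingHom.mem_ker, twistAlgHom_eq_C φ ρ 0 this]

lemma ker_twistAlgHom_succ_le (φ : MvPolynomial σ k →ₐ[k] D) (ρ : σ → ℕ) (c : ℕ) :
    RingHom.ker (twistAlgHom φ ρ (c + 1)) ≤ RingHom.ker (twistAlgHom φ ρ c) := by
  have h : twistAlgHom φ ρ c = ((aeval fun i => if ρ i < c then X i else 1 :
      MvPolynomial σ D →ₐ[D] MvPolynomial σ D).restrictScalars k).comp
        (twistAlgHom φ ρ (c + 1)) := by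
    ext1 i
    by_cases h1 : ρ i < c
    · simp [twistAlgHom_X, h1, Nat.lt_succ_of_lt h1]
    · by_cases h2 : ρ i < c + 1 <;> simp [twistAlgHom_X, h1, h2]
  intro g hg
  rw [RingHom.mem_ker] at hg ⊢
  rw [h, AlgHom.comp_apply, hg, map_zero]

/-- A lower bound for the height of the kernel of `φ`. If the kernel contains binomials
`X j ^ b - g` for which the leading variables `X j` are triangular with respect to the ranking `ρ`,
then the kernels of the twists of `φ` form a strictly descending chain of primes. -/
lemma le_height_ker_of_triangular [IsDomain D] (φ : MvPolynomial σ k →ₐ[k] D) (ρ : σ → ℕ)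
    {r b : ℕ} (hb : b ≠ 0)
    (h : ∀ c < r, ∃ j, ρ j = c ∧ φ (X j) ≠ 0 ∧
      ∃ g ∈ Algebra.adjoin k (X '' {i | c + 1 ≤ ρ i}), φ (X j ^ b) = φ g) :
    (r : ℕ∞) ≤ (RingHom.ker φ).height := by
  have key (n : ℕ) : ∀ c, c + n = r → (n : ℕ∞) ≤ (RingHom.ker (twistAlgHom φ ρ c)).height := by
    induction n with
    | zero => simp
    | succ n ih =>
      intro c hc
      obtain ⟨j, hj, hj0, g, hg, hjg⟩ := h c (by omega)
      have hlt : RingHom.ker (twistAlgHom φ ρ (c + 1)) < RingHom.ker (twistAlgHom φ ρ c) := by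
        refine lt_of_le_of_ne (ker_twistAlgHom_succ_le φ ρ c) fun heq => ?_
        have hmem : X j ^ b - g ∈ RingHom.ker (twistAlgHom φ ρ c) := by
          have hg' : g ∈ Algebra.adjoin k (X '' {i | c ≤ ρ i}) :=
            Algebra.adjoin_mono (Set.image_mono fun i hi => (Nat.le_succ c).trans hi) hg
          rw [RingHom.mem_ker, map_sub, map_pow, twistAlgHom_eq_C φ ρ c hg', twistAlgHom_X]
          simp [hj, ← hjg]
        rw [← heq, RingHom.mem_ker, map_sub, map_pow, twistAlgHom_eq_C φ ρ (c + 1) hg,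
          twistAlgHom_X, ← hjg, map_pow, map_pow, if_pos (by omega), mul_pow, sub_eq_zero,
          mul_eq_left₀ (pow_ne_zero _ (by simpa using hj0))] at hmem
        have := congrArg MvPolynomial.totalDegree hmem
        rw [totalDegree_X_pow, totalDegree_one] at this
        exact hb this
      have hprime (c : ℕ) : (RingHom.ker (twistAlgHom φ ρ c)).IsPrime := RingHom.ker_isPrime _
      calc ((n + 1 : ℕ) : ℕ∞) = n + 1 := by push_cast; rfl
        _ ≤ (RingHom.ker (twistAlgHom φ ρ (c + 1))).height + 1 := by
          gcongr; exact ih (c + 1) (by omega)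
        _ ≤ _ := Ideal.height_add_one_le_of_lt_of_isPrime hlt
  have := key r 0 (by omega)
  rwa [ker_twistAlgHom_zero] at this

/-- An ideal generated by at most `r` elements and of height at least `r` is generated by
exactly as many elements as its height, by Krull's height theorem. -/
lemma spanFinrank_eq_height_of_le {R : Type*} [CommRing R] [IsNoetherianRing R] {I : Ideal R}
    (hI : I ≠ ⊤) {r : ℕ} (F : Fin r → R) (hF : I = Ideal.span (Set.range F))
    (hr : (r : ℕ∞) ≤ I.height) : (I.spanFinrank : ℕ∞) = I.height := by
  refine le_antisymm (le_trans ?_ hr) (Ideal.height_le_spanFinrank I hI)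
  have h1 := Submodule.spanFinrank_span_le_ncard_of_finite (R := R) (Set.finite_range F)
  have h2 : (Set.range F).ncard ≤ r := by
    rw [← Set.image_univ]
    exact (Set.ncard_image_le Set.finite_univ).trans (by simp)
  rw [hF]
  exact_mod_cast h1.trans h2

end HeightOfKernel

/-! ### Representations by the generators of the semigroup -/

section Arithmetic

lemma geomGen_zero (a b r : ℕ) : geomGen a b r 0 = a ^ r := by simp [geomGen]

lemma geomGen_succ (a b r : ℕ) (i : Fin (r + 1)) :
    geomGen a b (r + 1) i.succ = b * geomGen a b r i := by
  simp only [geomGen, Fin.val_succ, Nat.add_sub_add_right]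
  ring

lemma geomGen_mul_eq (a b r : ℕ) (i : Fin r) :
    geomGen a b r i.castSucc * b = geomGen a b r i.succ * a := by
  simp only [geomGen, Fin.val_succ, Fin.val_castSucc]
  obtain ⟨c, hc⟩ : ∃ c, r - (i : ℕ) = c + 1 := ⟨r - i - 1, by omega⟩
  rw [hc, show r - ((i : ℕ) + 1) = c by omega]
  ring

lemma geomGen_le {a b : ℕ} (hab : a ≤ b) (r : ℕ) (i : Fin (r + 1)) : geomGen a b r i ≤ b ^ r := by
  calc a ^ (r - (i : ℕ)) * b ^ (i : ℕ) ≤ b ^ (r - (i : ℕ)) * b ^ (i : ℕ) := by gcongr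
    _ = b ^ r := by rw [← pow_add]; congr 1; omega

/-- The generators other than the first are divisible by `b`, and the first is prime to `b`: a
representation by the generators is determined by residues modulo `b`, one coefficient at a time. -/
lemma eq_of_sum_mul_geomGen_eq {a b : ℕ} (hb : 0 < b) (hcop : Nat.Coprime a b) (r : ℕ)
    (f g : Fin (r + 1) → ℕ) (h : ∑ i, f i * geomGen a b r i = ∑ i, g i * geomGen a b r i)
    (hmod : ∀ i : Fin r, f i.castSucc ≡ g i.castSucc [MOD b] → f i.castSucc = g i.castSucc) :
    f = g := by
  induction r with
  | zero =>
    funext i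
    fin_cases i
    simpa [geomGen] using h
  | succ r ih =>
    have hsum (f : Fin (r + 2) → ℕ) : ∑ i, f i * geomGen a b (r + 1) i =
        f 0 * a ^ (r + 1) + b * ∑ i : Fin (r + 1), f i.succ * geomGen a b r i := by
      rw [Fin.sum_univ_succ, geomGen_zero, Finset.mul_sum]
      simp only [geomGen_succ, mul_left_comm]
    rw [hsum, hsum] at h
    have h0 : f 0 = g 0 := by
      refine hmod 0 ?_
      have h1 : f 0 * a ^ (r + 1) ≡ g 0 * a ^ (r + 1) [MOD b] := by
        have := congrArg (· % b) h
        simpa [Nat.ModEq, Nat.add_mod] using this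
      exact Nat.ModEq.cancel_right_of_coprime (Nat.Coprime.pow_right _ hcop.symm) h1
    rw [h0] at h
    have htail := ih (fun i => f i.succ) (fun i => g i.succ)
      (Nat.eq_of_mul_eq_mul_left hb (Nat.add_left_cancel h)) fun i hi => hmod i.succ hi
    funext i
    refine Fin.cases h0 (fun i => congrFun htail i) i

end Arithmetic

open MvPolynomial

/-! ### The binomials generate the ideal of the projective closure -/

section Exponents

/-- The exponent of `u, v` in the image under `geomProjParam` of the monomial with exponent `d`. -/
noncomputable def geomExp (a b r : ℕ) (d : Fin (r + 2) →₀ ℕ) : Fin 2 →₀ ℕ :=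
  Finsupp.single 0 (∑ i : Fin (r + 1), d i.succ * geomGen a b r i) +
    Finsupp.single 1 (d 0 * b ^ r + ∑ i : Fin (r + 1), d i.succ * (b ^ r - geomGen a b r i))

lemma geomExp_add (a b r : ℕ) (d e : Fin (r + 2) →₀ ℕ) :
    geomExp a b r (d + e) = geomExp a b r d + geomExp a b r e := by
  simp only [geomExp, Finsupp.add_apply, add_mul, Finset.sum_add_distrib, Finsupp.single_add]
  abel

lemma geomProjParam_monomial (k : Type u) [Field k] (a b r : ℕ) (d : Fin (r + 2) →₀ ℕ) (c : k) :
    geomProjParam k a b r (monomial d c) = monomial (geomExp a b r d) c := by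
  rw [geomProjParam, aeval_monomial, Finsupp.prod_fintype _ _ (by simp), Fin.prod_univ_succ,
    geomExp, monomial_eq]
  rw [Finsupp.prod_fintype _ _ (by simp), Fin.prod_univ_two]
  simp [mul_pow, ← pow_mul, Finset.prod_mul_distrib, Finset.prod_pow_eq_pow_sum, pow_add,
    mul_comm, MvPolynomial.algebraMap_eq, mul_left_comm]

lemma sum_eq_of_geomExp_eq {a b r : ℕ} {d e : Fin (r + 2) →₀ ℕ}
    (h : geomExp a b r d = geomExp a b r e) :
    ∑ i : Fin (r + 1), d i.succ * geomGen a b r i =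
      ∑ i : Fin (r + 1), e i.succ * geomGen a b r i := by
  simpa [geomExp] using DFunLike.congr_fun h 0

lemma geomExp_one_add {a b : ℕ} (hab : a ≤ b) (r : ℕ) (d : Fin (r + 2) →₀ ℕ) :
    geomExp a b r d 1 + ∑ i : Fin (r + 1), d i.succ * geomGen a b r i =
      b ^ r * ∑ i, d i := by
  have h1 : geomExp a b r d 1 =
    d 0 * b ^ r + ∑ i : Fin (r + 1), d i.succ * (b ^ r - geomGen a b r i) := by simp [geomExp]
  rw [h1, add_assoc, ← Finset.sum_add_distrib, Fin.sum_univ_succ (fun i => d i), mul_add,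
    mul_comm, Finset.mul_sum]
  congr 1
  refine Finset.sum_congr rfl fun i _ => ?_
  rw [← mul_add, Nat.sub_add_cancel (geomGen_le hab r i), mul_comm]

lemma eq_of_geomExp_eq {a b r : ℕ} (hab : a < b) (hcop : Nat.Coprime a b)
    {d e : Fin (r + 2) →₀ ℕ} (h : geomExp a b r d = geomExp a b r e)
    (hmod : ∀ i : Fin r, d i.castSucc.succ ≡ e i.castSucc.succ [MOD b] →
      d i.castSucc.succ = e i.castSucc.succ) : d = e := by
  have h1 := eq_of_sum_mul_geomGen_eq (Nat.zero_lt_of_lt hab) hcop r _ _ (sum_eq_of_geomExp_eq h)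
    hmod
  have h2 := (geomExp_one_add hab.le r d).symm.trans <| (congrArg₂ (· + ·)
    (DFunLike.congr_fun h 1) (sum_eq_of_geomExp_eq h)).trans (geomExp_one_add hab.le r e)
  have h3 := Nat.eq_of_mul_eq_mul_left (pow_pos (Nat.zero_lt_of_lt hab) r) h2
  rw [Fin.sum_univ_succ (fun i => d i), Fin.sum_univ_succ (fun i => e i),
    Finset.sum_congr rfl fun i _ => congrFun h1 i] at h3
  ext i
  exact Fin.cases (Nat.add_right_cancel h3) (congrFun h1) i

end Exponents

section Binomials

variable (k : Type u) [Field k] (a b r : ℕ)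

/-- The binomials `z_i ^ b - z_{i+1} ^ a` generating the ideal of the affine curve. -/
noncomputable def geomBinomial (i : Fin r) : MvPolynomial (Fin (r + 1)) k :=
  X i.castSucc ^ b - X i.succ ^ a

/-- The binomials `z_i ^ b - z_0 ^ (b - a) * z_{i+1} ^ a` generating the ideal of the projective
closure; the homogenizing variable `z_0` has index `0`. -/
noncomputable def geomProjBinomial (i : Fin r) : MvPolynomial (Fin (r + 2)) k :=
  X i.castSucc.succ ^ b - X 0 ^ (b - a) * X i.succ.succ ^ a

variable {a b}

lemma geomExp_single_mul_eq (hab : a ≤ b) (i : Fin r) :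
    geomExp a b r (Finsupp.single i.castSucc.succ b) =
      geomExp a b r (Finsupp.single 0 (b - a) + Finsupp.single i.succ.succ a) := by
  have h1 := geomGen_mul_eq a b r i
  have h2 := geomGen_le hab r i.castSucc
  have h3 := geomGen_le hab r i.succ
  have hv : b * (b ^ r - geomGen a b r i.castSucc) =
      (b - a) * b ^ r + a * (b ^ r - geomGen a b r i.succ) := by
    zify [hab, h2, h3] at h1 ⊢
    linear_combination -h1
  simp only [geomExp, Finsupp.single_apply, Finsupp.add_apply, Fin.succ_inj, Fin.succ_ne_zero,
    (Fin.succ_ne_zero _).symm, if_true, if_false, ite_mul, zero_mul, zero_add, add_zero,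
    Finset.sum_ite_eq, Finset.mem_univ]
  rw [hv, mul_comm b, h1, mul_comm a (geomGen a b r i.succ)]

lemma geomProjBinomial_mem_ker (hab : a ≤ b) (i : Fin r) :
    geomProjBinomial k a b r i ∈ RingHom.ker (geomProjParam k a b r) := by
  rw [RingHom.mem_ker, geomProjBinomial, X_pow_eq_monomial, X_pow_eq_monomial, X_pow_eq_monomial,
    monomial_mul, map_sub, geomProjParam_monomial, geomProjParam_monomial,
    geomExp_single_mul_eq r hab, mul_one, sub_self]

/-- Every monomial reduces, modulo the binomials, to one in which `z_i` for `1 ≤ i ≤ r` has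
exponent less than `b`: replacing `z_i ^ b` lowers the degree in `z_1, …, z_{r+1}` by `b - a`. -/
lemma exists_reduced (hab : a < b) (d : Fin (r + 2) →₀ ℕ) :
    ∃ d' : Fin (r + 2) →₀ ℕ, (∀ i : Fin r, d' i.castSucc.succ < b) ∧
      geomExp a b r d = geomExp a b r d' ∧
      monomial d (1 : k) - monomial d' 1 ∈ Ideal.span (Set.range (geomProjBinomial k a b r)) := by
  induction hn : ∑ i : Fin (r + 1), d i.succ using Nat.strong_induction_on generalizing d with
  | _ n ih =>
  by_cases hd : ∀ i : Fin r, d i.castSucc.succ < b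
  · exact ⟨d, hd, rfl, by simp⟩
  push Not at hd
  obtain ⟨i, hi⟩ := hd
  obtain ⟨e, rfl⟩ : ∃ e, d = e + Finsupp.single i.castSucc.succ b :=
    ⟨d - Finsupp.single i.castSucc.succ b, (tsub_add_cancel_of_le (by simpa using hi)).symm⟩
  obtain ⟨d', hd', hexp, hmem⟩ := ih _ (by
    rw [← hn]
    simp only [Finsupp.add_apply, Finset.sum_add_distrib, Finsupp.single_apply, Fin.succ_inj,
      (Fin.succ_ne_zero _).symm, if_false, Finset.sum_ite_eq, Finset.mem_univ, if_true,
      zero_add]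
    gcongr) (e + (Finsupp.single 0 (b - a) + Finsupp.single i.succ.succ a)) rfl
  refine ⟨d', hd', ?_, ?_⟩
  · rw [← hexp, geomExp_add, geomExp_add, geomExp_single_mul_eq r hab.le]
  · have : monomial (e + Finsupp.single i.castSucc.succ b) (1 : k) - monomial d' 1 =
        monomial e 1 * geomProjBinomial k a b r i +
          (monomial (e + (Finsupp.single 0 (b - a) + Finsupp.single i.succ.succ a)) 1 -
            monomial d' 1) := by
      rw [geomProjBinomial, X_pow_eq_monomial, X_pow_eq_monomial, X_pow_eq_monomial, monomial_mul,
        mul_sub, monomial_mul, monomial_mul]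
      simp
    rw [this]
    exact add_mem (Ideal.mul_mem_left _ _ (Ideal.subset_span ⟨i, rfl⟩)) hmem

lemma monomial_sub_monomial_mem_span (hab : a < b) (hcop : Nat.Coprime a b)
    {d e : Fin (r + 2) →₀ ℕ} (h : geomExp a b r d = geomExp a b r e) :
    monomial d (1 : k) - monomial e 1 ∈ Ideal.span (Set.range (geomProjBinomial k a b r)) := by
  obtain ⟨d', hd', hde, hdm⟩ := exists_reduced k r hab d
  obtain ⟨e', he', hee, hem⟩ := exists_reduced k r hab e
  obtain rfl : d' = e' := eq_of_geomExp_eq hab hcop (hde.symm.trans (h.trans hee)) fun i hi =>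
    Nat.ModEq.eq_of_lt_of_lt hi (hd' i) (he' i)
  simpa using sub_mem hdm hem

end Binomials

/-- If an algebra homomorphism `φ` maps the monomial with exponent `d` to the monomial with exponent
`θ d`, then its kernel is generated by the differences of monomials with equal images. -/
lemma ker_le_of_monomial_sub_monomial_mem {k σ τ : Type*} [Field k]
    (φ : MvPolynomial σ k →ₐ[k] MvPolynomial τ k) (θ : (σ →₀ ℕ) → (τ →₀ ℕ))
    (hφ : ∀ d c, φ (monomial d c) = monomial (θ d) c) (I : Ideal (MvPolynomial σ k))
    (hI : ∀ d e, θ d = θ e → monomial d (1 : k) - monomial e 1 ∈ I) : RingHom.ker φ ≤ I := by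
  -- The linear map `s` picks a preimage of every monomial in the image of `φ`.
  let s : MvPolynomial τ k →ₗ[k] MvPolynomial σ k :=
    (basisMonomials τ k).constr k fun t => monomial (Function.invFun θ t) 1
  have hs (t : τ →₀ ℕ) : s (monomial t 1) = monomial (Function.invFun θ t) 1 := by
    rw [← congrFun (coe_basisMonomials τ k) t]; exact (basisMonomials τ k).constr_basis k _ t
  have key (f : MvPolynomial σ k) : f - s (φ f) ∈ I := by
    induction f using MvPolynomial.induction_on' with
    | monomial d c =>
      have h1 := I.mul_mem_left (C c) (hI d _ (Function.invFun_eq ⟨d, rfl⟩).symm)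
      have h2 : s (monomial (θ d) c) = C c * monomial (Function.invFun θ (θ d)) 1 := by
        rw [← hs, ← smul_eq_C_mul, ← map_smul, smul_monomial, smul_eq_mul, mul_one]
      rwa [mul_sub, C_mul_monomial, mul_one, ← h2, ← hφ] at h1
    | add p q hp hq =>
      rw [map_add, map_add, add_sub_add_comm]
      exact add_mem hp hq
  intro f hf
  have := key f
  rwa [(RingHom.mem_ker).1 hf, map_zero, sub_zero] at this

lemma ker_geomProjParam (k : Type u) [Field k] {a b : ℕ} (r : ℕ) (hab : a < b)
    (hcop : Nat.Coprime a b) :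
    RingHom.ker (geomProjParam k a b r) = Ideal.span (Set.range (geomProjBinomial k a b r)) := by
  refine le_antisymm (ker_le_of_monomial_sub_monomial_mem _ (geomExp a b r)
    (geomProjParam_monomial k a b r) _ fun d e h =>
      monomial_sub_monomial_mem_span k r hab hcop h) (Ideal.span_le.2 ?_)
  rintro _ ⟨i, rfl⟩
  exact geomProjBinomial_mem_ker k r hab.le i

/-! ### Homogenization -/

section Homogenization

lemma homogenizePoly_eq_sum {k : Type u} [Field k] {n : ℕ} (f : MvPolynomial (Fin n) k)
    {s : Finset (Fin n →₀ ℕ)} (hs : f.support ⊆ s) :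
    homogenizePoly f =
      ∑ d ∈ s, monomial (Finsupp.cons (f.totalDegree - d.degree) d) (f.coeff d) :=
  Finset.sum_subset hs fun d _ hd => by rw [notMem_support_iff.1 hd, monomial_zero]

/-- Setting the homogenizing variable to `1` undoes the homogenization. -/
lemma aeval_cons_one_homogenizePoly {k : Type u} [Field k] {n : ℕ}
    (f : MvPolynomial (Fin n) k) :
    aeval (Fin.cons 1 X : Fin (n + 1) → MvPolynomial (Fin n) k) (homogenizePoly f) = f := by
  conv_rhs => rw [← f.support_sum_monomial_coeff]
  rw [homogenizePoly, map_sum]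
  refine Finset.sum_congr rfl fun d _ => ?_
  rw [aeval_monomial, Finsupp.prod_fintype _ _ (by simp), Fin.prod_univ_succ, monomial_eq,
    Finsupp.prod_fintype _ _ (by simp)]
  simp [MvPolynomial.algebraMap_eq]

variable (k : Type u) [Field k] (a b r : ℕ)

lemma coe_geomParam (f : MvPolynomial (Fin (r + 1)) k) :
    (geomParam k a b r f : Polynomial k) =
      aeval (fun i => (Polynomial.X : Polynomial k) ^ geomGen a b r i) f := by
  have : (geomRing k a b r).val.comp (geomParam k a b r) =
      aeval fun i => (Polynomial.X : Polynomial k) ^ geomGen a b r i := by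
    ext1 i; simp [geomParam]
  exact DFunLike.congr_fun this f

lemma geomParam_surjective : Function.Surjective (geomParam k a b r) := by
  rintro ⟨y, hy⟩
  rw [geomRing, Algebra.adjoin_range_eq_range_aeval] at hy
  obtain ⟨p, rfl⟩ := hy
  exact ⟨p, Subtype.ext (coe_geomParam k a b r p)⟩

lemma coe_geomParam_monomial (d : Fin (r + 1) →₀ ℕ) (c : k) :
    (geomParam k a b r (monomial d c) : Polynomial k) =
      Polynomial.monomial (∑ i, d i * geomGen a b r i) c := by
  rw [coe_geomParam, aeval_monomial, Finsupp.prod_fintype _ _ (by simp)]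
  simp [← pow_mul, Finset.prod_pow_eq_pow_sum, Polynomial.C_mul_X_pow_eq_monomial, mul_comm]

lemma geomBinomial_mem_geomIdeal (i : Fin r) :
    geomBinomial k a b r i ∈ geomIdeal k a b r := by
  rw [geomIdeal, RingHom.mem_ker, geomBinomial]
  apply Subtype.ext
  rw [coe_geomParam]
  simp [← pow_mul, geomGen_mul_eq]

variable {a b}

lemma geomExp_cons (hab : a ≤ b) {D : ℕ} (d : Fin (r + 1) →₀ ℕ) (hd : d.degree ≤ D) :
    geomExp a b r (Finsupp.cons (D - d.degree) d) =
      Finsupp.single 0 (∑ i, d i * geomGen a b r i) +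
        Finsupp.single 1 (b ^ r * D - ∑ i, d i * geomGen a b r i) := by
  have h1 := geomExp_one_add hab r (Finsupp.cons (D - d.degree) d)
  simp only [Fin.sum_univ_succ (fun i => Finsupp.cons (D - d.degree) d i), Finsupp.cons_succ,
    Finsupp.cons_zero, ← Finsupp.degree_eq_sum, Nat.sub_add_cancel hd] at h1
  rw [← h1, Nat.add_sub_cancel]
  ext i
  fin_cases i <;> simp [geomExp]

/-- The image of a homogenized polynomial under `geomProjParam` is a homogenization in `v` of its
image under `geomParam`. -/
lemma homogenizePoly_mem_ker (hab : a ≤ b) {f : MvPolynomial (Fin (r + 1)) k}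
    (hf : f ∈ geomIdeal k a b r) : homogenizePoly f ∈ RingHom.ker (geomProjParam k a b r) := by
  let s : Polynomial k →ₗ[k] MvPolynomial (Fin 2) k :=
    (Polynomial.basisMonomials k).constr k fun N =>
      monomial (Finsupp.single 0 N + Finsupp.single 1 (b ^ r * f.totalDegree - N)) 1
  have hs (N : ℕ) (c : k) : s (Polynomial.monomial N c) =
      monomial (Finsupp.single 0 N + Finsupp.single 1 (b ^ r * f.totalDegree - N)) c := by
    have h1 : s (Polynomial.monomial N 1) =
        monomial (Finsupp.single 0 N + Finsupp.single 1 (b ^ r * f.totalDegree - N)) 1 := by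
      rw [← congrFun (Polynomial.coe_basisMonomials k) N]
      exact (Polynomial.basisMonomials k).constr_basis k _ N
    rw [← mul_one c, ← smul_eq_mul, ← Polynomial.smul_monomial, map_smul, h1, smul_monomial]
  have key : geomProjParam k a b r (homogenizePoly f) = s (geomParam k a b r f : Polynomial k) := by
    conv_rhs => rw [← f.support_sum_monomial_coeff]
    rw [homogenizePoly, map_sum, map_sum, AddSubmonoidClass.coe_finsetSum, map_sum]
    refine Finset.sum_congr rfl fun d hd => ?_
    rw [geomProjParam_monomial, coe_geomParam_monomial, hs, geomExp_cons r hab]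
    exact le_totalDegree hd
  rw [RingHom.mem_ker, key, (RingHom.mem_ker).1 hf]
  simp

lemma homogenizePoly_geomBinomial (ha : 0 < a) (hab : a < b) (i : Fin r) :
    homogenizePoly (geomBinomial k a b r i) = geomProjBinomial k a b r i := by
  have hne : Finsupp.single i.castSucc b ≠ Finsupp.single i.succ a := fun h => by
    have := DFunLike.congr_fun h i.castSucc
    rw [Finsupp.single_eq_same, Finsupp.single_apply, if_neg (Fin.castSucc_lt_succ).ne'] at this
    omega
  have hf : geomBinomial k a b r i =
      monomial (Finsupp.single i.castSucc b) 1 - monomial (Finsupp.single i.succ a) 1 := by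
    rw [geomBinomial, X_pow_eq_monomial, X_pow_eq_monomial]
  have hc1 : coeff (Finsupp.single i.castSucc b) (geomBinomial k a b r i) = 1 := by
    simp [hf, coeff_monomial, hne.symm]
  have hc2 : coeff (Finsupp.single i.succ a) (geomBinomial k a b r i) = -1 := by
    simp [hf, coeff_monomial, hne]
  have hdeg : (geomBinomial k a b r i).totalDegree = b := by
    apply le_antisymm
    · refine (totalDegree_sub _ _).trans ?_
      simp [totalDegree_X_pow, hab.le]
    · have := le_totalDegree (p := geomBinomial k a b r i)
        (s := Finsupp.single i.castSucc b) (by simp [mem_support_iff, hc1])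
      simpa using this
  rw [homogenizePoly_eq_sum (s := {Finsupp.single i.castSucc b, Finsupp.single i.succ a}),
    Finset.sum_pair hne, hc1, hc2, hdeg, geomProjBinomial, X_pow_eq_monomial, X_pow_eq_monomial,
    X_pow_eq_monomial, monomial_mul, mul_one, map_neg, ← sub_eq_add_neg]
  · have h1 : Finsupp.cons (b - (Finsupp.single i.castSucc b).degree)
        (Finsupp.single i.castSucc b) = Finsupp.single i.castSucc.succ b := by
      ext j
      refine Fin.cases ?_ (fun j => ?_) j <;> simp [Finsupp.single_apply, Fin.succ_inj]
    have h2 : Finsupp.cons (b - (Finsupp.single i.succ a).degree) (Finsupp.single i.succ a) =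
        Finsupp.single 0 (b - a) + Finsupp.single i.succ.succ a := by
      ext j
      refine Fin.cases ?_ (fun j => ?_) j <;>
        simp [Finsupp.single_apply, Fin.succ_inj, (Fin.succ_ne_zero _).symm]
    rw [h1, h2]
  · intro d hd
    contrapose! hd
    simp only [Finset.mem_insert, Finset.mem_singleton, not_or] at hd
    simp [hf, coeff_monomial, Ne.symm hd.1, Ne.symm hd.2]

lemma geomProjIdeal_eq_ker (ha : 0 < a) (hab : a < b) (hcop : Nat.Coprime a b) :
    geomProjIdeal k a b r = RingHom.ker (geomProjParam k a b r) := by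
  apply le_antisymm
  · refine Ideal.span_le.2 ?_
    rintro _ ⟨f, hf, rfl⟩
    exact homogenizePoly_mem_ker k r hab.le hf
  · rw [ker_geomProjParam k r hab hcop, Ideal.span_le]
    rintro _ ⟨i, rfl⟩
    exact Ideal.subset_span ⟨_, geomBinomial_mem_geomIdeal k a b r i,
      homogenizePoly_geomBinomial k r ha hab i⟩

lemma geomIdeal_eq_span (hab : a < b) (hcop : Nat.Coprime a b) :
    geomIdeal k a b r = Ideal.span (Set.range (geomBinomial k a b r)) := by
  apply le_antisymm
  · intro f hf
    have h1 := homogenizePoly_mem_ker k r hab.le hf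
    rw [ker_geomProjParam k r hab hcop] at h1
    have h2 := Ideal.mem_map_of_mem
      (aeval (Fin.cons 1 X : Fin (r + 2) → MvPolynomial (Fin (r + 1)) k)) h1
    rw [aeval_cons_one_homogenizePoly, Ideal.map_span, ← Set.range_comp] at h2
    have h3 : aeval (Fin.cons 1 X : Fin (r + 2) → MvPolynomial (Fin (r + 1)) k) ∘
        geomProjBinomial k a b r = geomBinomial k a b r := by
      funext i
      simp only [Function.comp_apply, geomProjBinomial, geomBinomial, map_sub, map_mul, map_pow,
        aeval_X, Fin.cons_zero, Fin.cons_succ, one_pow, one_mul]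
    rwa [h3] at h2
  · rw [Ideal.span_le]
    rintro _ ⟨i, rfl⟩
    exact geomBinomial_mem_geomIdeal k a b r i

end Homogenization

/-! ### Heights of the defining ideals -/

section CompleteIntersection

variable (k : Type u) [Field k] {a b : ℕ} (r : ℕ)

lemma le_height_geomIdeal (hab : a < b) : (r : ℕ∞) ≤ (geomIdeal k a b r).height := by
  refine le_height_ker_of_triangular (geomParam k a b r) (fun i => i) (Nat.zero_lt_of_lt hab).ne'
    fun c hc => ⟨(⟨c, hc⟩ : Fin r).castSucc, rfl, ?_, X (⟨c, hc⟩ : Fin r).succ ^ a,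
      pow_mem (Algebra.subset_adjoin (Set.mem_image_of_mem X (by simp))) _, ?_⟩
  · intro h
    have := congrArg Subtype.val h
    simp [coe_geomParam] at this
  · have := geomBinomial_mem_geomIdeal k a b r ⟨c, hc⟩
    rwa [geomIdeal, RingHom.mem_ker, geomBinomial, map_sub, sub_eq_zero] at this

lemma le_height_ker_geomProjParam (hab : a < b) :
    (r : ℕ∞) ≤ (RingHom.ker (geomProjParam k a b r)).height := by
  -- The homogenizing variable is ranked last, together with the last variable of the affine curve.
  refine le_height_ker_of_triangular (geomProjParam k a b r) (Fin.cons r fun i => i)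
    (Nat.zero_lt_of_lt hab).ne'
    fun c hc => ⟨(⟨c, hc⟩ : Fin r).castSucc.succ, rfl, ?_,
      X 0 ^ (b - a) * X (⟨c, hc⟩ : Fin r).succ.succ ^ a,
      ?_, ?_⟩
  · rw [geomProjParam, aeval_X, Fin.cons_succ]
    exact mul_ne_zero (pow_ne_zero _ (X_ne_zero _)) (pow_ne_zero _ (X_ne_zero _))
  · have hX (i : Fin (r + 2)) (hi : c + 1 ≤ (Fin.cons r fun i => i : Fin (r + 2) → ℕ) i) :
        (X i : MvPolynomial (Fin (r + 2)) k) ∈ Algebra.adjoin k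
          (X '' {i | c + 1 ≤ (Fin.cons r fun i => i : Fin (r + 2) → ℕ) i}) :=
      Algebra.subset_adjoin ⟨i, hi, rfl⟩
    exact mul_mem (pow_mem (hX 0 hc) _)
      (pow_mem (hX (⟨c, hc⟩ : Fin r).succ.succ (le_refl (c + 1))) _)
  · have := geomProjBinomial_mem_ker k r hab.le ⟨c, hc⟩
    rwa [RingHom.mem_ker, geomProjBinomial, map_sub, sub_eq_zero] at this

end CompleteIntersection

/-! ### The coordinate ring over a Noether normalization -/

section BoxExponents

variable {r : ℕ}

/-- The exponent with entries `p 0`, `e 0, …, e (r - 1)`, `p 1`, in this order: the exponents of the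
two variables of `k[z_0, z_{r+1}]` are the outer ones. -/
noncomputable def boxExp (e : Fin r → ℕ) (p : Fin 2 →₀ ℕ) : Fin (r + 2) →₀ ℕ :=
  Finsupp.equivFunOnFinite.symm (Fin.cons (p 0) (Fin.snoc e (p 1) : Fin (r + 1) → ℕ))

@[simp] lemma boxExp_zero (e : Fin r → ℕ) (p : Fin 2 →₀ ℕ) : boxExp e p 0 = p 0 := rfl

@[simp] lemma boxExp_mid (e : Fin r → ℕ) (p : Fin 2 →₀ ℕ) (i : Fin r) :
    boxExp e p i.castSucc.succ = e i := by
  simp [boxExp]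

@[simp] lemma boxExp_last (e : Fin r → ℕ) (p : Fin 2 →₀ ℕ) :
    boxExp e p (Fin.last r).succ = p 1 := by
  simp [boxExp, -Fin.succ_last]

lemma exponent_ext {d d' : Fin (r + 2) →₀ ℕ} (h0 : d 0 = d' 0)
    (hmid : ∀ i : Fin r, d i.castSucc.succ = d' i.castSucc.succ)
    (hlast : d (Fin.last r).succ = d' (Fin.last r).succ) : d = d' := by
  ext j
  exact Fin.cases h0 (fun j => Fin.lastCases hlast hmid j) j

lemma boxExp_add (e e' : Fin r → ℕ) (p p' : Fin 2 →₀ ℕ) :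
    boxExp (e + e') (p + p') = boxExp e p + boxExp e' p' := by
  apply exponent_ext <;> intros <;>
    simp only [Finsupp.add_apply, boxExp_zero, boxExp_mid, boxExp_last, Pi.add_apply]

lemma exists_eq_boxExp (d : Fin (r + 2) →₀ ℕ) :
    ∃ p, d = boxExp (fun i => d i.castSucc.succ) p :=
  ⟨Finsupp.equivFunOnFinite.symm ![d 0, d (Fin.last r).succ], by
    apply exponent_ext <;> intros <;> simp only [boxExp_zero, boxExp_mid, boxExp_last] <;> rfl⟩

lemma boxExp_injective (e : Fin r → ℕ) : Function.Injective (boxExp e) := fun p q h => by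
  have h0 := DFunLike.congr_fun h 0
  have h1 := DFunLike.congr_fun h (Fin.last r).succ
  rw [boxExp_zero, boxExp_zero] at h0
  rw [boxExp_last, boxExp_last] at h1
  ext i
  fin_cases i
  exacts [h0, h1]

end BoxExponents

section NoetherNormalization

variable (k : Type u) [Field k] (a b r : ℕ)

/-- The inclusion of the polynomial ring in the first and the last variable. -/
noncomputable def outerVars : MvPolynomial (Fin 2) k →ₐ[k] MvPolynomial (Fin (r + 2)) k :=
  aeval ![X 0, X (Fin.last r).succ]

lemma outerVars_monomial (p : Fin 2 →₀ ℕ) (c : k) :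
    outerVars k r (monomial p c) = monomial (boxExp 0 p) c := by
  have h : boxExp (0 : Fin r → ℕ) p =
      Finsupp.single 0 (p 0) + Finsupp.single (Fin.last r).succ (p 1) := by
    apply exponent_ext
    · simp
    · intro i
      rw [boxExp_mid]
      simp [Fin.succ_inj, -Fin.succ_last]
    · rw [boxExp_last]
      simp [-Fin.succ_last]
  rw [outerVars, aeval_monomial, Finsupp.prod_fintype _ _ (by simp), Fin.prod_univ_two, h,
    ← mul_one c, ← C_mul_monomial, ← mul_one (1 : k), ← monomial_mul, mul_one]
  simp [X_pow_eq_monomial, MvPolynomial.algebraMap_eq]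

open Classical in
/-- The linear form on `k[u, v]` that, composed with `geomProjParam`, reads off the coefficient of
the socle monomial `z_1 ^ (b - 1) ⋯ z_r ^ (b - 1)` over the polynomial ring `k[z_0, z_{r+1}]`. -/
noncomputable def socleFormAux : MvPolynomial (Fin 2) k →ₗ[k] MvPolynomial (Fin 2) k :=
  (basisMonomials (Fin 2) k).constr k fun s =>
    if h : ∃ p, geomExp a b r (boxExp (fun _ => b - 1) p) = s then monomial h.choose 1 else 0

/-- The coefficient of `z_1 ^ (b - 1) ⋯ z_r ^ (b - 1)` over `k[z_0, z_{r+1}]`. -/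
noncomputable def socleForm : MvPolynomial (Fin (r + 2)) k →ₗ[k] MvPolynomial (Fin 2) k :=
  socleFormAux k a b r ∘ₗ (geomProjParam k a b r).toLinearMap

variable {a b}

lemma socleForm_eq_of_geomExp_eq {d d' : Fin (r + 2) →₀ ℕ}
    (h : geomExp a b r d = geomExp a b r d') (c : k) :
    socleForm k a b r (monomial d c) = socleForm k a b r (monomial d' c) := by
  simp [socleForm, geomProjParam_monomial, h]

lemma socleForm_monomial_boxExp (hab : a < b) (hcop : Nat.Coprime a b) {e : Fin r → ℕ}
    (he : ∀ i, e i ≡ b - 1 [MOD b] → e i = b - 1) (p : Fin 2 →₀ ℕ) :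
    socleForm k a b r (monomial (boxExp e p) 1) =
      if e = fun _ => b - 1 then monomial p 1 else 0 := by
  have huniq (q : Fin 2 →₀ ℕ)
      (h : geomExp a b r (boxExp (fun _ => b - 1) q) = geomExp a b r (boxExp e p)) :
      boxExp (fun _ => b - 1) q = boxExp e p :=
    eq_of_geomExp_eq hab hcop h fun i hi => by
      rw [boxExp_mid, boxExp_mid] at hi ⊢
      exact (he i hi.symm).symm
  rw [socleForm, LinearMap.comp_apply, AlgHom.toLinearMap_apply, geomProjParam_monomial,
    socleFormAux, ← congrFun (coe_basisMonomials (Fin 2) k) (geomExp a b r (boxExp e p)),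
    Module.Basis.constr_basis]
  split_ifs with h2 h3 h3
  · subst h3
    rw [boxExp_injective _ (huniq _ h2.choose_spec)]
  · refine absurd (_root_.funext fun i => ?_) h3
    have := DFunLike.congr_fun (huniq _ h2.choose_spec) i.castSucc.succ
    rwa [boxExp_mid, boxExp_mid, eq_comm] at this
  · exact absurd ⟨p, by rw [h3]⟩ h2
  · rfl

/-- Every monomial has the same image in `k[u, v]` as the product of a monomial in `z_0, z_{r+1}` and
a monomial in `z_1, …, z_r` with exponents less than `b`. -/
lemma exists_boxExp_reduced (hab : a < b) (d : Fin (r + 2) →₀ ℕ) :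
    ∃ (e : Fin r → Fin b) (p : Fin 2 →₀ ℕ),
      geomExp a b r d = geomExp a b r (boxExp (fun i => e i) p) := by
  -- Only the exponents matter here, so the coefficient field is immaterial.
  obtain ⟨d', hd', hexp, -⟩ := exists_reduced ℚ r hab d
  obtain ⟨p, hp⟩ := exists_eq_boxExp d'
  exact ⟨fun i => ⟨_, hd' i⟩, p, hexp.trans (congrArg _ hp)⟩

/-- The form `socleForm` is linear over `k[z_0, z_{r+1}]`. -/
lemma socleForm_outerVars_mul (hab : a < b) (hcop : Nat.Coprime a b)
    (g : MvPolynomial (Fin 2) k) (f : MvPolynomial (Fin (r + 2)) k) :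
    socleForm k a b r (outerVars k r g * f) = g * socleForm k a b r f := by
  have key (p : Fin 2 →₀ ℕ) (d : Fin (r + 2) →₀ ℕ) :
      socleForm k a b r (monomial (boxExp 0 p + d) 1) =
        monomial p 1 * socleForm k a b r (monomial d 1) := by
    obtain ⟨e, q, hd⟩ := exists_boxExp_reduced r hab d
    have he (i : Fin r) (hi : (e i : ℕ) ≡ b - 1 [MOD b]) : (e i : ℕ) = b - 1 :=
      Nat.ModEq.eq_of_lt_of_lt hi (e i).2 (by omega)
    have hd' : geomExp a b r (boxExp 0 p + d) =
        geomExp a b r (boxExp (fun i => e i) (p + q)) := by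
      rw [geomExp_add, hd, ← geomExp_add, ← boxExp_add, zero_add]
    rw [socleForm_eq_of_geomExp_eq k r hd, socleForm_eq_of_geomExp_eq k r hd',
      socleForm_monomial_boxExp k r hab hcop he, socleForm_monomial_boxExp k r hab hcop he]
    split_ifs
    · rw [monomial_mul, mul_one]
    · rw [mul_zero]
  have hmon {τ : Type} (d : τ →₀ ℕ) (c : k) : monomial d c = c • monomial d 1 := by
    rw [smul_monomial, smul_eq_mul, mul_one]
  induction g using MvPolynomial.induction_on' with
  | add g g' hg hg' => rw [map_add, add_mul, map_add, hg, hg', add_mul]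
  | monomial p c =>
    induction f using MvPolynomial.induction_on' with
    | add f f' hf hf' => rw [mul_add, map_add, hf, hf', map_add, mul_add]
    | monomial d c' =>
      rw [outerVars_monomial, monomial_mul, hmon, hmon p, hmon d, map_smul, map_smul, key,
        smul_mul_smul_comm]

end NoetherNormalization

section FrobeniusStructure

variable (k : Type u) [Field k] (a b r : ℕ)

/-- The homogeneous coordinate ring as an algebra over the polynomial ring `k[z_0, z_{r+1}]`. -/
noncomputable abbrev geomProjRingAlgebra :
    Algebra (MvPolynomial (Fin 2) k) (GeomProjRing k a b r) :=
  ((Ideal.Quotient.mk (geomProjIdeal k a b r)).comp (outerVars k r).toRingHom).toAlgebra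

/-- The module structure underlying `geomProjRingAlgebra`, recorded separately as a shortcut for
instance search. -/
noncomputable abbrev geomProjRingModule : Module (MvPolynomial (Fin 2) k) (GeomProjRing k a b r) :=
  (geomProjRingAlgebra k a b r).toModule

attribute [local instance] geomProjRingAlgebra geomProjRingModule

lemma smul_geomProjRing_mk (g : MvPolynomial (Fin 2) k) (f : MvPolynomial (Fin (r + 2)) k) :
    g • (Ideal.Quotient.mk (geomProjIdeal k a b r) f) =
      Ideal.Quotient.mk (geomProjIdeal k a b r) (outerVars k r g * f) := by
  rw [Algebra.smul_def, map_mul]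
  rfl

/-- The class of `z_1 ^ e_1 ⋯ z_r ^ e_r` in the homogeneous coordinate ring. -/
noncomputable def boxClass (e : Fin r → ℕ) : GeomProjRing k a b r :=
  Ideal.Quotient.mk _ (monomial (boxExp e 0) 1)

variable {a b}

lemma span_boxClass (ha : 0 < a) (hab : a < b) (hcop : Nat.Coprime a b) :
    Submodule.span (MvPolynomial (Fin 2) k)
      (Set.range fun e : Fin r → Fin b => boxClass k a b r fun i => e i) = ⊤ := by
  refine eq_top_iff.2 fun x _ => ?_
  obtain ⟨f, rfl⟩ := Ideal.Quotient.mk_surjective x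
  induction f using MvPolynomial.induction_on' with
  | add f f' hf hf' => rw [map_add]; exact add_mem (hf trivial) (hf' trivial)
  | monomial d c =>
    obtain ⟨e, p, hd⟩ := exists_boxExp_reduced r hab d
    have : Ideal.Quotient.mk (geomProjIdeal k a b r) (monomial d c) =
        (monomial p c : MvPolynomial (Fin 2) k) • boxClass k a b r fun i => e i := by
      rw [boxClass, smul_geomProjRing_mk, Ideal.Quotient.eq,
        geomProjIdeal_eq_ker k r ha hab hcop, RingHom.mem_ker, map_sub, outerVars_monomial,
        monomial_mul, mul_one, ← boxExp_add, zero_add, add_zero, geomProjParam_monomial,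
        geomProjParam_monomial, hd, sub_self]
    rw [this]
    exact Submodule.smul_mem _ _ (Submodule.subset_span ⟨e, rfl⟩)

/-- The form `socleForm` on the homogeneous coordinate ring. -/
noncomputable def socleFormQuotient (ha : 0 < a) (hab : a < b) (hcop : Nat.Coprime a b) :
    GeomProjRing k a b r →ₗ[MvPolynomial (Fin 2) k] MvPolynomial (Fin 2) k where
  toFun := QuotientAddGroup.lift _ (socleForm k a b r).toAddMonoidHom fun f hf => by
    have hf' : f ∈ geomProjIdeal k a b r := hf
    rw [geomProjIdeal_eq_ker k r ha hab hcop, RingHom.mem_ker] at hf'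
    simp [socleForm, hf']
  map_add' := map_add _
  map_smul' g x := by
    obtain ⟨f, rfl⟩ := Ideal.Quotient.mk_surjective x
    rw [smul_geomProjRing_mk]
    exact socleForm_outerVars_mul k r hab hcop g f

lemma socleFormQuotient_mk (ha : 0 < a) (hab : a < b) (hcop : Nat.Coprime a b)
    (f : MvPolynomial (Fin (r + 2)) k) :
    socleFormQuotient k r ha hab hcop (Ideal.Quotient.mk _ f) = socleForm k a b r f := rfl

/-- The monomials `z_1 ^ e_1 ⋯ z_r ^ e_r` with `e_i < b` are dual to their complements with respect
to the form `socleFormQuotient`. The exponents of a product are at most `2 * b - 2`, so they are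
congruent to `b - 1` only if they are equal to it. -/
lemma socleFormQuotient_boxClass_mul (ha : 0 < a) (hab : a < b) (hcop : Nat.Coprime a b)
    (e e' : Fin r → Fin b) :
    socleFormQuotient k r ha hab hcop
      ((boxClass k a b r fun i => e i) * boxClass k a b r fun i => b - 1 - e' i) =
        if e = e' then 1 else 0 := by
  rw [boxClass, boxClass, ← map_mul, monomial_mul, mul_one, ← boxExp_add, zero_add,
    socleFormQuotient_mk, socleForm_monomial_boxExp k r hab hcop]
  · have : ((fun i => (e i : ℕ)) + fun i => b - 1 - (e' i : ℕ)) = (fun _ => b - 1) ↔ e = e' := by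
      rw [funext_iff, funext_iff]
      refine forall_congr' fun i => ?_
      have h1 := (e i).2
      have h2 := (e' i).2
      rw [Pi.add_apply, Fin.ext_iff]
      omega
    simp only [this]
    rfl
  · intro i hi
    have h1 := (e i).2
    have h2 := (e' i).2
    rw [Pi.add_apply] at hi ⊢
    have hlt : (e i : ℕ) + (b - 1 - (e' i : ℕ)) < b + (b - 1) := by omega
    generalize (e i : ℕ) + (b - 1 - (e' i : ℕ)) = n at hi hlt
    rw [Nat.ModEq, Nat.mod_eq_of_lt (by omega : b - 1 < b)] at hi
    by_cases hn : n < b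
    · rwa [Nat.mod_eq_of_lt hn] at hi
    · rw [Nat.mod_eq_sub_mod (not_lt.1 hn), Nat.mod_eq_of_lt (by omega)] at hi
      omega

theorem geomProjRing_isGorensteinRing (ha : 0 < a) (hab : a < b) (hcop : Nat.Coprime a b) :
    IsGorensteinRing (GeomProjRing k a b r) := by
  have := ModuleCat.hasInjectiveDimensionLE_mvPolynomial 2
    (ModuleCat.of (MvPolynomial (Fin 2) k) (MvPolynomial (Fin 2) k))
  have := hasInjectiveDimensionLE_of_dual (span_boxClass k r ha hab hcop)
    (socleFormQuotient_boxClass_mul k r ha hab hcop) 2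
  exact IsGorensteinRing.of_hasInjectiveDimensionLE 2

theorem geomProjRing_isCohenMacaulayRing (ha : 0 < a) (hab : a < b) (hcop : Nat.Coprime a b) :
    IsCohenMacaulayRing (GeomProjRing k a b r) := by
  have hspan := span_boxClass k r ha hab hcop
  let bas := Module.Basis.mk
    (linearIndependent_of_dual (socleFormQuotient_boxClass_mul k r ha hab hcop)) hspan.ge
  have := Module.Free.of_basis bas
  have := Module.Finite.of_basis bas
  refine IsCohenMacaulayRing.of_finite_flat (R := MvPolynomial (Fin 2) k) ?_
  rw [MvPolynomial.ringKrullDim_of_isNoetherianRing, ringKrullDim_eq_zero_of_field]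
  simp

end FrobeniusStructure

theorem mainTheorem12 {k : Type u} [Field k] (a b r : ℕ) (ha : 0 < a) (hab : a < b)
    (hcop : Nat.Coprime a b) :
    IsCompleteIntersectionVia (geomParam k a b r) ∧
      geomProjIdeal k a b r = RingHom.ker (geomProjParam k a b r) ∧
      IsCompleteIntersectionVia (Ideal.Quotient.mkₐ k (geomProjIdeal k a b r)) ∧
      IsCohenMacaulayRing (GeomProjRing k a b r) ∧
      IsGorensteinRing (GeomProjRing k a b r) := by
  have hker := geomProjIdeal_eq_ker k r ha hab hcop
  refine ⟨⟨geomParam_surjective k a b r, ?_⟩, hker, ⟨Ideal.Quotient.mkₐ_surjective k _, ?_⟩,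
    geomProjRing_isCohenMacaulayRing k r ha hab hcop, geomProjRing_isGorensteinRing k r ha hab hcop⟩
  · exact spanFinrank_eq_height_of_le (RingHom.ker_ne_top _) (geomBinomial k a b r)
      (geomIdeal_eq_span k r hab hcop) (le_height_geomIdeal k r hab)
  · have hmk : RingHom.ker (Ideal.Quotient.mkₐ k (geomProjIdeal k a b r)) =
        RingHom.ker (geomProjParam k a b r) := (Ideal.Quotient.mkₐ_ker k _).trans hker
    rw [hmk]
    exact spanFinrank_eq_height_of_le (RingHom.ker_ne_top _) (geomProjBinomial k a b r)
      (ker_geomProjParam k r hab hcop) (le_height_ker_geomProjParam k r hab)
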